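/- Let $\mathcal D$ be the usual dyadic grid in $\mathbb R$, i.e. the set of intervals $[k2^{-n},(k+1)2^{-n})$ with $n,k\in\mathbb Z$. For $I\in\mathcal D$ let $|I|$ be its length, let $I_-$ and $I_+$ be its left and right dyadic halves, and for a function $f$ that is Bochner integrable on $I$ put $\langle f\rangle_I=\frac1{|I|}\int_I f(x)\,dx$. Let $J\in\mathcal D$, let $E$ be a separable (real or complex) Hilbert space, let $2\le p<\infty$ and $\frac1p+\frac1q=1$, and let $f\in L^p(J;E)$ and $g\in L^q(J;E)$. Then the series over all dyadic intervals $I\subseteq J$ (including $I=J$) below converges, and $$\frac1{4|J|}\sum_{I\in\mathcal D,\ I\subseteq J}|I|\,\bigl\|\langle f\rangle_{I_+}-\langle f\rangle_{I_-}\bigr\|_E\,\bigl\|\langle g\rangle_{I_+}-\langle g\rangle_{I_-}\bigr\|_E\le(p-1)\,\bigl\langle\|f\|_E^p\bigr\rangle_J^{1/p}\,\bigl\langle\|g\|_E^q\bigr\rangle_J^{1/q}.$$ -/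

import Mathlib

open MeasureTheory

/-- An interval of the usual dyadic grid on the real line, encoded by the pair `(scale, index)`
of integers `(n, k)`; the interval is `[k 2⁻ⁿ, (k + 1) 2⁻ⁿ)`. Different pairs give different
intervals. -/
@[ext]
structure DyadicInterval where
  scale : ℤ
  index : ℤ

namespace DyadicInterval

/-- The underlying half-open interval `[k 2⁻ⁿ, (k + 1) 2⁻ⁿ)`. -/
def toSet (I : DyadicInterval) : Set ℝ :=
  Set.Ico ((I.index : ℝ) * (2 : ℝ) ^ (-I.scale)) (((I.index : ℝ) + 1) * (2 : ℝ) ^ (-I.scale))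

/-- The left dyadic half `I₋`. -/
def left (I : DyadicInterval) : DyadicInterval := ⟨I.scale + 1, 2 * I.index⟩

/-- The right dyadic half `I₊`. -/
def right (I : DyadicInterval) : DyadicInterval := ⟨I.scale + 1, 2 * I.index + 1⟩

/-- The length `|I|`, i.e. the Lebesgue measure of `I`. -/
noncomputable def length (I : DyadicInterval) : ℝ := volume.real I.toSet

/-- The average `⟨f⟩_I = |I|⁻¹ ∫_I f(x) dx` of a vector-valued function (Bochner integral). -/
noncomputable def avg {E : Type*} [NormedAddCommGroup E] [NormedSpace ℝ E]
    (I : DyadicInterval) (f : ℝ → E) : E :=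
  (I.length)⁻¹ • ∫ x in I.toSet, f x

end DyadicInterval

/-! This is a Bellman function argument built on Burkholder's function `U(a, b)`. Passing from an
interval to its halves moves the average of `f` by `±u` and that of `g` by `±v`, and the Haar term
is `4|I|‖u‖‖v‖`. Run alongside a vector `y`, starting at `0`, which moves by `±k` with `‖k‖ ≤ ‖u‖`
and `⟨k, v⟩ = ‖u‖‖v‖`. Averaging `⟨y, ⟨g⟩⟩` over the two halves then gains exactly `‖u‖‖v‖`, while
the average of `U(‖⟨f⟩‖, ‖y‖)` does not increase (`burkholder_add_burkholder_le`). At the last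
generation, Young's inequality bounds `⟨y, ⟨g⟩⟩`, `rpow_le_rpow_add_burkholder` trades `‖y‖^p` for
`(p-1)^p ‖⟨f⟩‖^p` plus a multiple of `U`, and Jensen returns to `f` and `g`. Since `U(a, 0) ≤ 0`,
this bounds every finite sum (`inner_avg_add_haarSum_le`); homogeneity turns the additive bound into
the product. -/

/-! ### Burkholder's function: concavity and majorization. -/

/-- Burkholder's function in terms of the norms `a`, `b` of its two arguments. -/
noncomputable def burkholder (p a b : ℝ) : ℝ := (b - (p - 1) * a) * (a + b) ^ (p - 1)

theorem hasDerivAt_burkholder_comp {p : ℝ} {a b : ℝ → ℝ} {a' b' t : ℝ}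
    (hs : 0 < a t + b t) (hda : HasDerivAt a a' t) (hdb : HasDerivAt b b' t) :
    HasDerivAt (fun s => burkholder p (a s) (b s))
      (p * (p - 1) * (a t + b t) ^ (p - 2) * (b t * b' - a t * a')
        - p * (p - 2) * (a t + b t) ^ (p - 1) * b') t := by
  have h := (hdb.sub (hda.const_mul (p - 1))).mul
    ((hda.add hdb).rpow_const (p := p - 1) (Or.inl hs.ne'))
  refine h.congr_deriv ?_
  have e : (a t + b t) ^ (p - 1) = (a t + b t) ^ (p - 2) * (a t + b t) := by
    rw [← Real.rpow_add_one hs.ne']; congr 1; ring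
  simp only [Pi.add_apply, Pi.sub_apply]
  rw [show p - 1 - 1 = p - 2 by ring, e]
  ring

/-- With `s = a + b` and `w = b b' - a a'`, the first derivative involves only `s`, `w` and `b'`.
Differentiating again, the terms containing `s'` combine to `-p(p-1)(p-2) s^(p-3) a (s')²`; what
remains has the signs of `κ` and `-b''`. -/
theorem concaveOn_burkholder_comp {p κ : ℝ} (hp : 2 ≤ p) (hκ : κ ≤ 0)
    {a b a' b' b'' : ℝ → ℝ} (ha : ∀ t, 0 < a t) (hb : ∀ t, 0 < b t)
    (hda : ∀ t, HasDerivAt a (a' t) t) (hdb : ∀ t, HasDerivAt b (b' t) t)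
    (hdb' : ∀ t, HasDerivAt b' (b'' t) t) (hb'' : ∀ t, 0 ≤ b'' t)
    (hw : ∀ t, HasDerivAt (fun s => b s * b' s - a s * a' s) κ t) :
    ConcaveOn ℝ Set.univ (fun t => burkholder p (a t) (b t)) := by
  have hs t : 0 < a t + b t := add_pos (ha t) (hb t)
  refine concaveOn_of_hasDerivWithinAt2_nonpos convex_univ
    (fun t _ => (hasDerivAt_burkholder_comp (hs t) (hda t) (hdb t)).continuousAt.continuousWithinAt)
    (fun t _ => (hasDerivAt_burkholder_comp (hs t) (hda t) (hdb t)).hasDerivWithinAt)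
    (fun t _ => HasDerivAt.hasDerivWithinAt
      (((((hda t).add (hdb t)).rpow_const (p := p - 2) (Or.inl (hs t).ne')).const_mul
        (p * (p - 1))).mul (hw t) |>.sub
        (((((hda t).add (hdb t)).rpow_const (p := p - 1) (Or.inl (hs t).ne')).const_mul
        (p * (p - 2))).mul (hdb' t))))
    (fun t _ => ?_)
  have e1 : (a t + b t) ^ (p - 1) = (a t + b t) ^ (p - 3) * (a t + b t) * (a t + b t) := by
    rw [← Real.rpow_add_one (hs t).ne', ← Real.rpow_add_one (hs t).ne']; congr 1; ring
  have e2 : (a t + b t) ^ (p - 2) = (a t + b t) ^ (p - 3) * (a t + b t) := by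
    rw [← Real.rpow_add_one (hs t).ne']; congr 1; ring
  simp only [Pi.add_apply]
  rw [show p - 1 - 1 = p - 2 by ring, show p - 2 - 1 = p - 3 by ring, e1, e2]
  have h3 : 0 < (a t + b t) ^ (p - 3) := Real.rpow_pos_of_pos (hs t) _
  set X := (a t + b t) ^ (p - 3)
  have k1 : 0 ≤ p * (p - 1) * (p - 2) * X * a t * (a' t + b' t) ^ 2 := by
    have := (ha t).le
    have : 0 ≤ p - 1 := by linarith
    have : 0 ≤ p - 2 := by linarith
    positivity
  have k2 : 0 ≤ p * (p - 1) * (X * (a t + b t)) * (-κ) := by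
    have := (hs t).le
    have : 0 ≤ p - 1 := by linarith
    have : 0 ≤ -κ := by linarith
    positivity
  have k3 : 0 ≤ p * (p - 2) * (X * (a t + b t) * (a t + b t)) * b'' t := by
    have := (hs t).le
    have := hb'' t
    have : 0 ≤ p - 2 := by linarith
    positivity
  linarith

section
variable {E : Type*} [NormedAddCommGroup E] [InnerProductSpace ℝ E]

theorem hasDerivAt_sqrt_norm_sq_add_sq (x h : E) {ε : ℝ} (hε : 0 < ε) (t : ℝ) :
    HasDerivAt (fun t : ℝ => √(‖x + t • h‖ ^ 2 + ε ^ 2))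
      (inner ℝ (x + t • h) h / √(‖x + t • h‖ ^ 2 + ε ^ 2)) t := by
  have h1 : HasDerivAt (fun t : ℝ => x + t • h) h t := by
    simpa using ((hasDerivAt_id t).smul_const h).const_add x
  refine ((h1.norm_sq.add_const (ε ^ 2)).sqrt (by positivity)).congr_deriv ?_
  rw [mul_div_mul_left _ _ two_ne_zero]

theorem hasDerivAt_inner_add_smul (x h : E) (t : ℝ) :
    HasDerivAt (fun t : ℝ => inner ℝ (x + t • h) h) (‖h‖ ^ 2) t := by
  have h1 : HasDerivAt (fun t : ℝ => x + t • h) h t := by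
    simpa using ((hasDerivAt_id t).smul_const h).const_add x
  simpa using h1.inner ℝ (hasDerivAt_const t h)

/-- The `ε` keeps the norms smooth and positive along lines. Then `w` is affine in `t` with slope
`‖k‖² - ‖h‖² ≤ 0`, and Cauchy–Schwarz gives convexity of the second root. -/
theorem concaveOn_burkholder_sqrt {p : ℝ} (hp : 2 ≤ p) {x y h k : E} (hk : ‖k‖ ≤ ‖h‖)
    {ε : ℝ} (hε : 0 < ε) :
    ConcaveOn ℝ Set.univ (fun t : ℝ =>
      burkholder p √(‖x + t • h‖ ^ 2 + ε ^ 2) √(‖y + t • k‖ ^ 2 + ε ^ 2)) := by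
  have hpos (z w : E) (t : ℝ) : 0 < √(‖z + t • w‖ ^ 2 + ε ^ 2) := by positivity
  refine concaveOn_burkholder_comp hp (κ := ‖k‖ ^ 2 - ‖h‖ ^ 2)
    (by nlinarith [norm_nonneg k, norm_nonneg h]) (hpos x h) (hpos y k)
    (hasDerivAt_sqrt_norm_sq_add_sq x h hε) (hasDerivAt_sqrt_norm_sq_add_sq y k hε)
    (fun t => (hasDerivAt_inner_add_smul y k t).div (hasDerivAt_sqrt_norm_sq_add_sq y k hε t)
      (hpos y k t).ne') (fun t => ?_) (fun t => ?_)
  · refine div_nonneg ?_ (by positivity)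
    rw [sub_nonneg, mul_div_assoc', div_le_iff₀ (hpos y k t), mul_assoc,
      Real.mul_self_sqrt (by positivity), ← sq]
    have := abs_real_inner_le_norm (y + t • k) k
    have h2 := sq_le_sq' (neg_le_of_abs_le this) (le_of_abs_le this)
    nlinarith [mul_nonneg (sq_nonneg ‖k‖) (sq_nonneg ε)]
  · have : (fun s : ℝ => √(‖y + s • k‖ ^ 2 + ε ^ 2) *
        (inner ℝ (y + s • k) k / √(‖y + s • k‖ ^ 2 + ε ^ 2)) - √(‖x + s • h‖ ^ 2 + ε ^ 2) *
        (inner ℝ (x + s • h) h / √(‖x + s • h‖ ^ 2 + ε ^ 2))) =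
        fun s : ℝ => inner ℝ (y + s • k) k - inner ℝ (x + s • h) h := by
      ext s
      rw [mul_div_cancel₀ _ (hpos y k s).ne', mul_div_cancel₀ _ (hpos x h s).ne']
    rw [this]
    exact (hasDerivAt_inner_add_smul y k t).sub (hasDerivAt_inner_add_smul x h t)

theorem continuous_burkholder {p : ℝ} (hp : 1 ≤ p) :
    Continuous fun z : ℝ × ℝ => burkholder p z.1 z.2 := by
  unfold burkholder
  have : Continuous fun z : ℝ × ℝ => (z.1 + z.2) ^ (p - 1) :=
    (continuous_fst.add continuous_snd).rpow_const fun _ => Or.inr (by linarith)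
  fun_prop

theorem burkholder_add_burkholder_le {p : ℝ} (hp : 2 ≤ p) {x y h k : E} (hk : ‖k‖ ≤ ‖h‖) :
    burkholder p ‖x + h‖ ‖y + k‖ + burkholder p ‖x - h‖ ‖y - k‖ ≤ 2 * burkholder p ‖x‖ ‖y‖ := by
  have key (ε : ℝ) (hε : ε ∈ Set.Ioi (0 : ℝ)) :
      burkholder p √(‖x + h‖ ^ 2 + ε ^ 2) √(‖y + k‖ ^ 2 + ε ^ 2) +
      burkholder p √(‖x - h‖ ^ 2 + ε ^ 2) √(‖y - k‖ ^ 2 + ε ^ 2) ≤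
      2 * burkholder p √(‖x‖ ^ 2 + ε ^ 2) √(‖y‖ ^ 2 + ε ^ 2) := by
    have := (concaveOn_burkholder_sqrt hp (x := x) (y := y) hk hε).2 (Set.mem_univ (1 : ℝ))
      (Set.mem_univ (-1 : ℝ)) one_half_pos.le one_half_pos.le (add_halves (1 : ℝ))
    norm_num [← sub_eq_add_neg] at this
    linarith
  have lim (u v : E) : Filter.Tendsto
      (fun ε : ℝ => burkholder p √(‖u‖ ^ 2 + ε ^ 2) √(‖v‖ ^ 2 + ε ^ 2))
      (nhdsWithin 0 (Set.Ioi 0)) (nhds (burkholder p ‖u‖ ‖v‖)) := by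
    have hc : Continuous fun ε : ℝ => burkholder p √(‖u‖ ^ 2 + ε ^ 2) √(‖v‖ ^ 2 + ε ^ 2) :=
      (continuous_burkholder (by linarith)).comp
        (f := fun ε : ℝ => (√(‖u‖ ^ 2 + ε ^ 2), √(‖v‖ ^ 2 + ε ^ 2))) (by fun_prop)
    simpa using (hc.tendsto 0).mono_left nhdsWithin_le_nhds
  exact le_of_tendsto_of_tendsto ((lim _ _).add (lim _ _)) ((lim _ _).const_mul 2)
    (Filter.eventually_of_mem self_mem_nhdsWithin key)

end

theorem hasDerivAt_rpow_sub_rpow_bound {p b c : ℝ} (hp : 2 ≤ p) (hb : 0 ≤ b) (hc : 0 < c) :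
    HasDerivAt (fun c => p * (b - c) * (((p - 1) * b + c) / p) ^ (p - 1) - b ^ p + c ^ p)
      (p * c * (c ^ (p - 2) - (((p - 1) * b + c) / p) ^ (p - 2))) c := by
  have hm : 0 < ((p - 1) * b + c) / p := by
    have : 0 ≤ (p - 1) * b := mul_nonneg (by linarith) hb
    positivity
  have h1 : HasDerivAt (fun c => ((p - 1) * b + c) / p) (1 / p) c :=
    ((hasDerivAt_id c).const_add _).div_const p
  have h2 : HasDerivAt (fun c => p * (b - c)) (p * (-1)) c :=
    ((hasDerivAt_id c).const_sub b).const_mul p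
  have h3 : HasDerivAt (fun c => c ^ p) (1 * p * c ^ (p - 1)) c :=
    (hasDerivAt_id c).rpow_const (Or.inl hc.ne')
  refine (((h2.mul (h1.rpow_const (p := p - 1) (Or.inl hm.ne'))).sub_const (b ^ p)).add
    h3).congr_deriv ?_
  have e1 : c ^ (p - 1) = c ^ (p - 2) * c := by
    rw [← Real.rpow_add_one hc.ne']; congr 1; ring
  have e2 : (((p - 1) * b + c) / p) ^ (p - 1) =
      (((p - 1) * b + c) / p) ^ (p - 2) * (((p - 1) * b + c) / p) := by
    rw [← Real.rpow_add_one hm.ne']; congr 1; ring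
  rw [show p - 1 - 1 = p - 2 by ring, e1, e2]
  have : p ≠ 0 := by linarith
  field_simp
  ring

/-- The base on the right is a weighted mean of `b` and `c`. So the derivative in `c` of the
difference of the two sides has the sign of `c - b`, and that difference has its minimum, zero, at
`c = b`. -/
theorem rpow_sub_rpow_le {p b c : ℝ} (hp : 2 ≤ p) (hb : 0 ≤ b) (hc : 0 ≤ c) :
    b ^ p - c ^ p ≤ p * (b - c) * (((p - 1) * b + c) / p) ^ (p - 1) := by
  have hp0 : 0 < p := by linarith
  set D : ℝ → ℝ := fun c => p * (b - c) * (((p - 1) * b + c) / p) ^ (p - 1) - b ^ p + c ^ p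
    with hD
  have hcont : Continuous D := by
    have h1 : Continuous fun c : ℝ => (((p - 1) * b + c) / p) ^ (p - 1) :=
      Continuous.rpow_const (by fun_prop) fun _ => Or.inr (by linarith)
    have h2 : Continuous fun c : ℝ => c ^ p :=
      continuous_id.rpow_const fun _ => Or.inr hp0.le
    fun_prop
  have hDb : D b = 0 := by simp [hD]
  suffices D b ≤ D c by rw [hDb] at this; simp only [hD] at this; linarith
  rcases le_total c b with h | h
  · refine antitoneOn_of_hasDerivWithinAt_nonpos (convex_Icc 0 b) hcont.continuousOn
      (fun x hx => (hasDerivAt_rpow_sub_rpow_bound hp hb ?_).hasDerivWithinAt) (fun x hx => ?_)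
      ⟨hc, h⟩ ⟨hb, le_rfl⟩ h
    · rw [interior_Icc] at hx; exact hx.1
    · rw [interior_Icc] at hx
      refine mul_nonpos_of_nonneg_of_nonpos (mul_nonneg hp0.le hx.1.le) (sub_nonpos.2 ?_)
      refine Real.rpow_le_rpow hx.1.le ?_ (by linarith)
      rw [le_div_iff₀ hp0]
      nlinarith [hx.2]
  · refine monotoneOn_of_hasDerivWithinAt_nonneg (convex_Ici b) hcont.continuousOn
      (fun x hx => (hasDerivAt_rpow_sub_rpow_bound hp hb ?_).hasDerivWithinAt) (fun x hx => ?_)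
      Set.self_mem_Ici h h
    · rw [interior_Ici] at hx; exact hb.trans_lt hx
    · rw [interior_Ici] at hx
      have hx' : b < x := hx
      refine mul_nonneg (mul_nonneg hp0.le (hb.trans hx'.le)) (sub_nonneg.2 ?_)
      have : 0 ≤ (p - 1) * b := mul_nonneg (by linarith) hb
      refine Real.rpow_le_rpow (div_nonneg (by linarith) hp0.le) ?_ (by linarith)
      rw [div_le_iff₀ hp0]
      nlinarith

theorem rpow_le_rpow_add_burkholder {p a b : ℝ} (hp : 2 ≤ p) (ha : 0 ≤ a) (hb : 0 ≤ b) :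
    b ^ p ≤ (p - 1) ^ p * a ^ p + p * ((p - 1) / p) ^ (p - 1) * burkholder p a b := by
  have hp1 : 0 ≤ p - 1 := by linarith
  -- With `c = (p-1)a` the weighted mean becomes a multiple of `a + b`, which produces `U`.
  have h := rpow_sub_rpow_le hp hb (mul_nonneg hp1 ha)
  rw [show ((p - 1) * b + (p - 1) * a) / p = (p - 1) / p * (a + b) by ring,
    Real.mul_rpow (div_nonneg hp1 (by linarith)) (add_nonneg ha hb), Real.mul_rpow hp1 ha] at h
  unfold burkholder
  linarith

theorem burkholder_zero_right_nonpos {p a : ℝ} (hp : 1 ≤ p) (ha : 0 ≤ a) :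
    burkholder p a 0 ≤ 0 := by
  have : 0 ≤ (p - 1) * a * a ^ (p - 1) :=
    mul_nonneg (mul_nonneg (by linarith) ha) (Real.rpow_nonneg ha _)
  simpa [burkholder] using this

/-! ### Dyadic intervals, averages and truncated Haar sums. -/

namespace DyadicInterval

theorem toSet_start_lt_end (I : DyadicInterval) :
    (I.index : ℝ) * (2 : ℝ) ^ (-I.scale) < ((I.index : ℝ) + 1) * (2 : ℝ) ^ (-I.scale) := by
  have : (0 : ℝ) < 2 ^ (-I.scale) := by positivity
  nlinarith

theorem length_eq (I : DyadicInterval) : I.length = (2 : ℝ) ^ (-I.scale) := by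
  have h : (0 : ℝ) < 2 ^ (-I.scale) := by positivity
  rw [length, toSet, Real.volume_real_Ico_of_le I.toSet_start_lt_end.le]
  ring

theorem length_pos (I : DyadicInterval) : 0 < I.length := by
  rw [length_eq]; positivity

theorem two_zpow_neg_scale_add_one (n : ℤ) : (2 : ℝ) ^ (-(n + 1)) = 2 ^ (-n) / 2 := by
  rw [neg_add, ← sub_eq_add_neg, zpow_sub₀ two_ne_zero, zpow_one]

theorem length_left (I : DyadicInterval) : I.left.length = I.length / 2 := by
  simp only [length_eq, left, two_zpow_neg_scale_add_one]

theorem length_right (I : DyadicInterval) : I.right.length = I.length / 2 := by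
  simp only [length_eq, right, two_zpow_neg_scale_add_one]

theorem toSet_left (I : DyadicInterval) :
    I.left.toSet = Set.Ico ((I.index : ℝ) * (2 : ℝ) ^ (-I.scale))
      (((I.index : ℝ) + 1 / 2) * (2 : ℝ) ^ (-I.scale)) := by
  simp only [toSet, left, two_zpow_neg_scale_add_one]
  congr 1 <;> push_cast <;> ring

theorem toSet_right (I : DyadicInterval) :
    I.right.toSet = Set.Ico (((I.index : ℝ) + 1 / 2) * (2 : ℝ) ^ (-I.scale))
      (((I.index : ℝ) + 1) * (2 : ℝ) ^ (-I.scale)) := by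
  simp only [toSet, right, two_zpow_neg_scale_add_one]
  congr 1 <;> push_cast <;> ring

theorem measurableSet_toSet (I : DyadicInterval) : MeasurableSet I.toSet := measurableSet_Ico

theorem volume_toSet_ne_top (I : DyadicInterval) : volume I.toSet ≠ ⊤ := measure_Ico_lt_top.ne

instance (I : DyadicInterval) : IsFiniteMeasure (volume.restrict I.toSet) :=
  isFiniteMeasure_restrict.2 I.volume_toSet_ne_top

theorem volume_toSet_ne_zero (I : DyadicInterval) : volume I.toSet ≠ 0 := fun h => by
  have := I.length_pos
  simp [length, measureReal_def, h] at this

theorem left_union_right (I : DyadicInterval) : I.left.toSet ∪ I.right.toSet = I.toSet := by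
  have h : (0 : ℝ) < 2 ^ (-I.scale) := by positivity
  rw [toSet_left, toSet_right, Set.Ico_union_Ico_eq_Ico (by nlinarith) (by nlinarith), toSet]

theorem disjoint_left_right (I : DyadicInterval) : Disjoint I.left.toSet I.right.toSet := by
  rw [toSet_left, toSet_right]
  exact Set.Ico_disjoint_Ico_same

theorem left_subset (I : DyadicInterval) : I.left.toSet ⊆ I.toSet :=
  I.left_union_right ▸ Set.subset_union_left

theorem right_subset (I : DyadicInterval) : I.right.toSet ⊆ I.toSet :=
  I.left_union_right ▸ Set.subset_union_right

theorem integrableOn_of_memLp {E : Type*} [NormedAddCommGroup E] {r : ℝ} (hr : 1 ≤ r) {I : DyadicInterval} {f : ℝ → E}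
    (hf : MemLp f (ENNReal.ofReal r) (volume.restrict I.toSet)) : IntegrableOn f I.toSet :=
  hf.integrable (by simpa using ENNReal.ofReal_le_ofReal hr)

theorem integrableOn_norm_rpow {E : Type*} [NormedAddCommGroup E] {r : ℝ} (hr : 1 ≤ r) {I : DyadicInterval} {f : ℝ → E}
    (hf : MemLp f (ENNReal.ofReal r) (volume.restrict I.toSet)) :
    IntegrableOn (fun x => ‖f x‖ ^ r) I.toSet := by
  have h := hf.integrable_norm_rpow (by simp; linarith) ENNReal.ofReal_ne_top
  rwa [ENNReal.toReal_ofReal (by linarith)] at h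

section
variable {E : Type*} [NormedAddCommGroup E] [NormedSpace ℝ E]

theorem setIntegral_eq_left_add_right (I : DyadicInterval) {f : ℝ → E}
    (hf : IntegrableOn f I.toSet) :
    ∫ x in I.toSet, f x = (∫ x in I.left.toSet, f x) + ∫ x in I.right.toSet, f x := by
  rw [← I.left_union_right, setIntegral_union I.disjoint_left_right I.right.measurableSet_toSet
    (hf.mono_set I.left_subset) (hf.mono_set I.right_subset)]

theorem avg_eq_half_smul (I : DyadicInterval) {f : ℝ → E} (hf : IntegrableOn f I.toSet) :
    I.avg f = (1 / 2 : ℝ) • (I.left.avg f + I.right.avg f) := by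
  have := I.length_pos.ne'
  rw [avg, avg, avg, length_left, length_right, setIntegral_eq_left_add_right I hf, ← smul_add,
    smul_smul]
  congr 1
  field_simp

theorem avg_const_smul (I : DyadicInterval) (c : ℝ) (f : ℝ → E) :
    I.avg (fun x => c • f x) = c • I.avg f := by
  rw [avg, avg, integral_smul, smul_comm]

theorem length_mul_avg (I : DyadicInterval) (f : ℝ → ℝ) :
    I.length * I.avg f = ∫ x in I.toSet, f x := by
  rw [avg, smul_eq_mul, mul_inv_cancel_left₀ I.length_pos.ne']

theorem avg_nonneg (I : DyadicInterval) {f : ℝ → ℝ} (hf : ∀ x, 0 ≤ f x) : 0 ≤ I.avg f :=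
  smul_nonneg (inv_nonneg.2 I.length_pos.le) (integral_nonneg hf)

theorem norm_avg_rpow_le {r : ℝ} (hr : 1 ≤ r) {I : DyadicInterval} {f : ℝ → E}
    (hf : MemLp f (ENNReal.ofReal r) (volume.restrict I.toSet)) :
    ‖I.avg f‖ ^ r ≤ I.avg fun x => ‖f x‖ ^ r := by
  have h1 : ‖I.avg f‖ ≤ I.avg fun x => ‖f x‖ := by
    rw [avg, avg, norm_smul, Real.norm_of_nonneg (inv_nonneg.2 I.length_pos.le), smul_eq_mul]
    exact mul_le_mul_of_nonneg_left (norm_integral_le_integral_norm _)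
      (inv_nonneg.2 I.length_pos.le)
  refine (Real.rpow_le_rpow (norm_nonneg _) h1 (by linarith)).trans ?_
  have h2 := (convexOn_rpow hr).map_set_average_le (μ := volume) (t := I.toSet)
    (f := fun x => ‖f x‖)
    (continuousOn_id.rpow_const fun _ _ => Or.inr (by linarith)) isClosed_Ici
    I.volume_toSet_ne_zero I.volume_toSet_ne_top (Filter.Eventually.of_forall fun x => norm_nonneg _)
    (integrableOn_of_memLp hr hf).norm (integrableOn_norm_rpow hr hf)
  rwa [setAverage_eq, setAverage_eq] at h2

/-- The summand belonging to `I` of the bilinear sum of Haar differences. -/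
noncomputable def haarTerm (f g : ℝ → E) (I : DyadicInterval) : ℝ :=
  I.length * ‖I.right.avg f - I.left.avg f‖ * ‖I.right.avg g - I.left.avg g‖

/-- The sum of `haarTerm` over the first `n` generations of descendants of an interval. -/
noncomputable def haarSum (f g : ℝ → E) : ℕ → DyadicInterval → ℝ
  | 0, _ => 0
  | n + 1, I => haarTerm f g I + haarSum f g n I.left + haarSum f g n I.right

theorem haarTerm_nonneg (f g : ℝ → E) (I : DyadicInterval) : 0 ≤ haarTerm f g I :=
  mul_nonneg (mul_nonneg I.length_pos.le (norm_nonneg _)) (norm_nonneg _)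

theorem haarTerm_smul {s t : ℝ} (hs : 0 ≤ s) (ht : 0 ≤ t) (f g : ℝ → E) (I : DyadicInterval) :
    haarTerm (fun x => s • f x) (fun x => t • g x) I = s * t * haarTerm f g I := by
  simp only [haarTerm, avg_const_smul, ← smul_sub, norm_smul, Real.norm_of_nonneg hs,
    Real.norm_of_nonneg ht]
  ring

theorem haarSum_smul {s t : ℝ} (hs : 0 ≤ s) (ht : 0 ≤ t) (f g : ℝ → E) (n : ℕ) :
    ∀ I : DyadicInterval,
      haarSum (fun x => s • f x) (fun x => t • g x) n I = s * t * haarSum f g n I := by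
  induction n with
  | zero => simp [haarSum]
  | succ n ih =>
    intro I
    rw [haarSum, haarSum, haarTerm_smul hs ht, ih, ih]
    ring

end

/-- The dyadic subintervals of an interval of the first `n` generations. -/
def descendants : ℕ → DyadicInterval → Set DyadicInterval
  | 0, _ => ∅
  | n + 1, I => insert I (descendants n I.left ∪ descendants n I.right)

/-- Comparing the index with the midpoint of `J` decides which half to descend into. The inequality
`n < m` is strict because `descendants m` consists of generations `0` to `m - 1`. -/
theorem mem_descendants_of_index (n : ℕ) : ∀ {I J : DyadicInterval}, I.scale = J.scale + n →
    J.index * 2 ^ n ≤ I.index → I.index < (J.index + 1) * 2 ^ n →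
    ∀ m, n < m → I ∈ descendants m J := by
  induction n with
  | zero =>
    intro I J h1 h2 h3 m hm
    obtain ⟨m, rfl⟩ := Nat.exists_eq_add_one.2 hm
    refine Or.inl (DyadicInterval.ext (by simpa using h1) ?_)
    simp at h2 h3
    lia
  | succ n ih =>
    intro I J h1 h2 h3 m hm
    obtain ⟨m, rfl⟩ : ∃ k, m = k + 1 := ⟨m - 1, by lia⟩
    refine Or.inr ?_
    rw [pow_succ] at h2 h3
    push_cast at h1
    rcases lt_or_ge I.index ((2 * J.index + 1) * 2 ^ n) with h | h
    · exact Or.inl (ih (by simp only [left]; lia) (by simp only [left]; linarith) h m (by lia))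
    · exact Or.inr (ih (by simp only [right]; lia) h (by simp only [right]; linarith) m (by lia))

theorem exists_mem_descendants {I J : DyadicInterval} (h : I.toSet ⊆ J.toSet) :
    ∃ n, ∀ m, n < m → I ∈ descendants m J := by
  have hle : I.length ≤ J.length := measureReal_mono h J.volume_toSet_ne_top
  rw [length_eq, length_eq, zpow_le_zpow_iff_right₀ one_lt_two] at hle
  obtain ⟨n, hn⟩ := Int.le.dest (neg_le_neg_iff.1 hle)
  rw [toSet, toSet, Set.Ico_subset_Ico_iff I.toSet_start_lt_end] at h
  have hz : (2 : ℝ) ^ (-J.scale) = 2 ^ n * 2 ^ (-I.scale) := by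
    rw [← zpow_natCast, ← zpow_add₀ two_ne_zero]; congr 1; lia
  have hI : (0 : ℝ) < 2 ^ (-I.scale) := by positivity
  rw [hz, ← mul_assoc, ← mul_assoc, mul_le_mul_iff_left₀ hI, mul_le_mul_iff_left₀ hI] at h
  refine ⟨n, mem_descendants_of_index n hn.symm (by exact_mod_cast h.1) ?_⟩
  have : I.index + 1 ≤ (J.index + 1) * 2 ^ n := by exact_mod_cast h.2
  lia

section
variable {E : Type*} [NormedAddCommGroup E] [NormedSpace ℝ E]

open Classical in
theorem sum_haarTerm_le_haarSum (f g : ℝ → E) (n : ℕ) : ∀ {J : DyadicInterval}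
    (s : Finset DyadicInterval), (∀ I ∈ s, I ∈ descendants n J) →
    ∑ I ∈ s, haarTerm f g I ≤ haarSum f g n J := by
  induction n with
  | zero =>
    intro J s hs
    rw [Finset.eq_empty_of_forall_notMem fun I hI => hs I hI]
    simp [haarSum]
  | succ n ih =>
    intro J s hs
    set l := s.filter (· ∈ descendants n J.left)
    set r := s.filter (· ∈ descendants n J.right)
    have hsub : s ⊆ {J} ∪ (l ∪ r) := fun I hI => by
      rcases hs I hI with h | h | h
      · simp [h]
      · simp [l, hI, h]
      · simp [r, hI, h]
    -- Nonnegative terms make subadditivity enough, so disjointness of the two families is not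
    -- needed.
    have hunion (a b : Finset DyadicInterval) : ∑ I ∈ a ∪ b, haarTerm f g I ≤
        ∑ I ∈ a, haarTerm f g I + ∑ I ∈ b, haarTerm f g I := by
      rw [← Finset.sum_union_inter]
      exact le_add_of_nonneg_right (Finset.sum_nonneg fun I _ => haarTerm_nonneg f g I)
    have h1 := Finset.sum_le_sum_of_subset_of_nonneg hsub fun I _ _ => haarTerm_nonneg f g I
    have h2 := hunion {J} (l ∪ r)
    have h3 := hunion l r
    have h4 := ih l fun I hI => (Finset.mem_filter.1 hI).2
    have h5 := ih r fun I hI => (Finset.mem_filter.1 hI).2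
    rw [Finset.sum_singleton] at h2
    rw [haarSum]
    linarith

theorem exists_sum_haarTerm_le_haarSum (f g : ℝ → E) {J : DyadicInterval}
    (s : Finset {I : DyadicInterval // I.toSet ⊆ J.toSet}) :
    ∃ n, ∑ I ∈ s, haarTerm f g I ≤ haarSum f g n J := by
  choose N hN using fun I : {I : DyadicInterval // I.toSet ⊆ J.toSet} =>
    exists_mem_descendants I.2
  refine ⟨s.sup N + 1, ?_⟩
  have := sum_haarTerm_le_haarSum f g (s.sup N + 1) (J := J)
    (s.map (Function.Embedding.subtype _)) fun I hI => by
      obtain ⟨K, hK, rfl⟩ := Finset.mem_map.1 hI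
      exact hN K _ (Nat.lt_succ_of_le (Finset.le_sup hK))
  simpa using this

end

end DyadicInterval

theorem exists_norm_le_inner_eq {E : Type*} [NormedAddCommGroup E] [InnerProductSpace ℝ E]
    (u v : E) : ∃ k : E, ‖k‖ ≤ ‖u‖ ∧ inner ℝ k v = ‖u‖ * ‖v‖ := by
  rcases eq_or_ne v 0 with rfl | hv
  · exact ⟨0, by simp⟩
  · have : ‖v‖ ≠ 0 := norm_ne_zero_iff.2 hv
    refine ⟨(‖u‖ / ‖v‖) • v, ?_, ?_⟩
    · rw [norm_smul, norm_div, norm_norm, norm_norm, div_mul_cancel₀ _ this]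
    · rw [real_inner_smul_left, real_inner_self_eq_norm_sq]
      field_simp

/-! ### The Bellman induction and its consequences. -/

namespace DyadicInterval

section
variable {E : Type*} [NormedAddCommGroup E] [InnerProductSpace ℝ E]

/-- The vector `y` is universally quantified so that the induction can pass to `y + k` on the right
half and `y - k` on the left. -/
theorem inner_avg_add_haarSum_le {p q : ℝ} (hp : 2 ≤ p) (hpq : p.HolderConjugate q)
    {f g : ℝ → E} (n : ℕ) : ∀ {I : DyadicInterval},
    MemLp f (ENNReal.ofReal p) (volume.restrict I.toSet) →
    MemLp g (ENNReal.ofReal q) (volume.restrict I.toSet) → ∀ y : E,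
    I.length * inner ℝ y (I.avg g) + haarSum f g n I / 4 ≤
      I.length * (((p - 1) / p) ^ (p - 1) * burkholder p ‖I.avg f‖ ‖y‖) +
      ((p - 1) ^ p / p * (∫ x in I.toSet, ‖f x‖ ^ p) + 1 / q * ∫ x in I.toSet, ‖g x‖ ^ q) := by
  have hp0 : 0 < p := by linarith
  have hq0 : 0 < q := hpq.symm.pos
  have hq1 : 1 ≤ q := hpq.symm.lt.le
  have hc : 0 ≤ ((p - 1) / p) ^ (p - 1) :=
    Real.rpow_nonneg (div_nonneg (by linarith) hp0.le) _
  induction n with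
  | zero =>
    intro I hf hg y
    have h1 := (real_inner_le_norm y (I.avg g)).trans
      (Real.young_inequality_of_nonneg (norm_nonneg _) (norm_nonneg _) hpq)
    have h2 := rpow_le_rpow_add_burkholder hp (norm_nonneg (I.avg f)) (norm_nonneg y)
    have h3 := norm_avg_rpow_le (by linarith) hf
    have h4 := norm_avg_rpow_le hq1 hg
    have h5 : ‖y‖ ^ p / p ≤ (p - 1) ^ p / p * (I.avg fun x => ‖f x‖ ^ p) +
        ((p - 1) / p) ^ (p - 1) * burkholder p ‖I.avg f‖ ‖y‖ := by
      rw [div_le_iff₀ hp0]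
      have h6 := mul_le_mul_of_nonneg_left h3 (Real.rpow_nonneg (by linarith : 0 ≤ p - 1) p)
      have h7 : (p - 1) ^ p / p * (I.avg fun x => ‖f x‖ ^ p) * p =
        (p - 1) ^ p * (I.avg fun x => ‖f x‖ ^ p) := by field_simp
      linarith
    have h8 := (div_le_div_iff_of_pos_right hq0).2 h4
    rw [haarSum, ← length_mul_avg, ← length_mul_avg]
    calc _ = I.length * inner ℝ y (I.avg g) := by ring
      _ ≤ _ := mul_le_mul_of_nonneg_left (h1.trans (add_le_add h5 h8)) I.length_pos.le
      _ = _ := by ring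
  | succ n ih =>
    intro I hf hg y
    have hfi := avg_eq_half_smul I (integrableOn_of_memLp (by linarith) hf)
    have hgi := avg_eq_half_smul I (integrableOn_of_memLp hq1 hg)
    set u : E := (1 / 2 : ℝ) • (I.right.avg f - I.left.avg f) with hu
    set v : E := (1 / 2 : ℝ) • (I.right.avg g - I.left.avg g) with hv
    have hfr : I.right.avg f = I.avg f + u := by rw [hfi, hu]; module
    have hfl : I.left.avg f = I.avg f - u := by rw [hfi, hu]; module
    have hgr : I.right.avg g = I.avg g + v := by rw [hgi, hv]; module
    have hgl : I.left.avg g = I.avg g - v := by rw [hgi, hv]; module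
    -- Adding the two halves leaves the cross term `|I|⟨k, v⟩ = |I|‖u‖‖v‖`, a quarter of the Haar
    -- term; `‖k‖ ≤ ‖u‖` is what concavity requires.
    obtain ⟨k, hk, hkv⟩ := exists_norm_le_inner_eq u v
    have hr := ih (hf.mono_measure (Measure.restrict_mono_set _ I.right_subset))
      (hg.mono_measure (Measure.restrict_mono_set _ I.right_subset)) (y + k)
    have hl := ih (hf.mono_measure (Measure.restrict_mono_set _ I.left_subset))
      (hg.mono_measure (Measure.restrict_mono_set _ I.left_subset)) (y - k)
    have hterm : haarTerm f g I = 4 * (I.length * (‖u‖ * ‖v‖)) := by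
      rw [haarTerm, hu, hv, norm_smul, norm_smul]
      norm_num
      ring
    have hU := mul_le_mul_of_nonneg_left (mul_le_mul_of_nonneg_left
      (burkholder_add_burkholder_le hp (x := I.avg f) (y := y) hk) hc) I.length_pos.le
    rw [haarSum, hterm, setIntegral_eq_left_add_right I (integrableOn_norm_rpow (by linarith) hf),
      setIntegral_eq_left_add_right I (integrableOn_norm_rpow hq1 hg)]
    rw [hfr, hgr, length_right, inner_add_left, inner_add_right, inner_add_right, hkv] at hr
    rw [hfl, hgl, length_left, inner_sub_left, inner_sub_right, inner_sub_right, hkv] at hl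
    linarith

theorem haarSum_le_of_avg_le_one {p q : ℝ} (hp : 2 ≤ p) (hpq : p.HolderConjugate q)
    {f g : ℝ → E} (n : ℕ) {J : DyadicInterval}
    (hf : MemLp f (ENNReal.ofReal p) (volume.restrict J.toSet))
    (hg : MemLp g (ENNReal.ofReal q) (volume.restrict J.toSet))
    (hf1 : (p - 1) ^ p * (J.avg fun x => ‖f x‖ ^ p) ≤ 1) (hg1 : (J.avg fun x => ‖g x‖ ^ q) ≤ 1) :
    haarSum f g n J / 4 ≤ J.length := by
  -- At `y = 0` the inner product vanishes and the `U` term is nonpositive, leaving `1/p + 1/q = 1`.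
  have h := inner_avg_add_haarSum_le hp hpq n hf hg 0
  have hp0 : 0 < p := by linarith
  rw [inner_zero_left, norm_zero, ← length_mul_avg, ← length_mul_avg] at h
  have h0 : ((p - 1) / p) ^ (p - 1) * burkholder p ‖J.avg f‖ 0 ≤ 0 :=
    mul_nonpos_of_nonneg_of_nonpos (Real.rpow_nonneg (div_nonneg (by linarith) hp0.le) _)
      (burkholder_zero_right_nonpos (by linarith) (norm_nonneg _))
  have h1 : (p - 1) ^ p / p * (J.avg fun x => ‖f x‖ ^ p) ≤ p⁻¹ := by
    rw [div_mul_eq_mul_div, inv_eq_one_div]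
    exact (div_le_div_iff_of_pos_right hp0).2 hf1
  have h2 : 1 / q * (J.avg fun x => ‖g x‖ ^ q) ≤ q⁻¹ := by
    rw [one_div]
    exact mul_le_of_le_one_right (inv_nonneg.2 hpq.symm.pos.le) hg1
  have h3 := hpq.inv_add_inv_eq_one
  have h4 := mul_le_mul_of_nonneg_left (add_le_add h0 (add_le_add h1 h2)) J.length_pos.le
  rw [h3] at h4
  linarith

theorem avg_norm_inv_smul_rpow_le_one {r M : ℝ} (hr : 0 < r) (hM : 0 < M) {f : ℝ → E}
    {J : DyadicInterval} (h : (J.avg fun x => ‖f x‖ ^ r) ^ (1 / r) ≤ M) {c : ℝ} (hc : 0 < c) :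
    c ^ r * (J.avg fun x => ‖(c * M)⁻¹ • f x‖ ^ r) ≤ 1 := by
  have h0 : 0 ≤ J.avg fun x => ‖f x‖ ^ r :=
    J.avg_nonneg fun x => Real.rpow_nonneg (norm_nonneg _) _
  have h1 : (J.avg fun x => ‖f x‖ ^ r) ≤ M ^ r := by
    have := Real.rpow_le_rpow (Real.rpow_nonneg h0 _) h hr.le
    rwa [← Real.rpow_mul h0, one_div_mul_cancel hr.ne', Real.rpow_one] at this
  have h2 : (fun x => ‖(c * M)⁻¹ • f x‖ ^ r) = fun x => ((c * M) ^ r)⁻¹ • ‖f x‖ ^ r := by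
    ext x
    rw [norm_smul, Real.norm_of_nonneg (by positivity),
      Real.mul_rpow (by positivity) (norm_nonneg _), Real.inv_rpow (by positivity), smul_eq_mul]
  rw [h2, avg_const_smul, Real.mul_rpow hc.le hM.le, smul_eq_mul]
  have hc' : 0 < c ^ r := Real.rpow_pos_of_pos hc r
  have hM' : 0 < M ^ r := Real.rpow_pos_of_pos hM r
  rw [mul_inv, mul_assoc, mul_inv_cancel_left₀ hc'.ne', inv_mul_le_one₀ hM']
  exact h1

/-- Rescale `f` by `(p-1)(A+ε)` and `g` by `B+ε` to reach the normalized case, then let `ε → 0`; the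
`ε` covers vanishing `A` or `B`. -/
theorem haarSum_le {p q : ℝ} (hp : 2 ≤ p) (hpq : p.HolderConjugate q)
    {f g : ℝ → E} (n : ℕ) {J : DyadicInterval}
    (hf : MemLp f (ENNReal.ofReal p) (volume.restrict J.toSet))
    (hg : MemLp g (ENNReal.ofReal q) (volume.restrict J.toSet)) :
    1 / (4 * J.length) * haarSum f g n J ≤
      (p - 1) * (J.avg fun x => ‖f x‖ ^ p) ^ (1 / p) * (J.avg fun x => ‖g x‖ ^ q) ^ (1 / q) := by
  set A := (J.avg fun x => ‖f x‖ ^ p) ^ (1 / p)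
  set B := (J.avg fun x => ‖g x‖ ^ q) ^ (1 / q)
  have hA0 : 0 ≤ A :=
    Real.rpow_nonneg (J.avg_nonneg fun x => Real.rpow_nonneg (norm_nonneg _) _) _
  have hB0 : 0 ≤ B :=
    Real.rpow_nonneg (J.avg_nonneg fun x => Real.rpow_nonneg (norm_nonneg _) _) _
  have hp1 : 0 < p - 1 := by linarith
  have key (ε : ℝ) (hε : ε ∈ Set.Ioi (0 : ℝ)) :
      1 / (4 * J.length) * haarSum f g n J ≤ (p - 1) * (A + ε) * (B + ε) := by
    have hε0 : 0 < ε := hε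
    have hAε : 0 < A + ε := by linarith
    have hBε : 0 < B + ε := by linarith
    have hg1 := avg_norm_inv_smul_rpow_le_one hpq.symm.pos hBε
      (le_add_of_nonneg_right hε0.le : B ≤ B + ε) one_pos
    rw [Real.one_rpow, one_mul] at hg1
    have h := haarSum_le_of_avg_le_one hp hpq n (hf.const_smul ((p - 1) * (A + ε))⁻¹)
      (hg.const_smul (1 * (B + ε))⁻¹)
      (avg_norm_inv_smul_rpow_le_one (by linarith) hAε (le_add_of_nonneg_right hε0.le : A ≤ A + ε) hp1)
      hg1
    change haarSum (fun x => ((p - 1) * (A + ε))⁻¹ • f x) (fun x => (1 * (B + ε))⁻¹ • g x) n J / 4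
      ≤ _ at h
    rw [haarSum_smul (by positivity) (by positivity)] at h
    have hl := J.length_pos
    rw [one_div_mul_eq_div, div_le_iff₀ (by positivity)]
    rw [one_mul, ← mul_inv, inv_mul_eq_div, div_div, div_le_iff₀ (by positivity)] at h
    linarith
  have lim : Filter.Tendsto (fun ε : ℝ => (p - 1) * (A + ε) * (B + ε))
      (nhdsWithin 0 (Set.Ioi 0)) (nhds ((p - 1) * A * B)) := by
    have hc : Continuous fun ε : ℝ => (p - 1) * (A + ε) * (B + ε) := by fun_prop
    simpa using (hc.tendsto 0).mono_left nhdsWithin_le_nhds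
  exact ge_of_tendsto lim (Filter.eventually_of_mem self_mem_nhdsWithin key)

theorem sum_haarTerm_le {p q : ℝ} (hp : 2 ≤ p) (hpq : p.HolderConjugate q)
    {f g : ℝ → E} {J : DyadicInterval}
    (hf : MemLp f (ENNReal.ofReal p) (volume.restrict J.toSet))
    (hg : MemLp g (ENNReal.ofReal q) (volume.restrict J.toSet))
    (s : Finset {I : DyadicInterval // I.toSet ⊆ J.toSet}) :
    ∑ I ∈ s, haarTerm f g I.1 ≤ (4 * J.length) * ((p - 1) *
      (J.avg fun x => ‖f x‖ ^ p) ^ (1 / p) * (J.avg fun x => ‖g x‖ ^ q) ^ (1 / q)) := by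
  obtain ⟨n, hn⟩ := exists_sum_haarTerm_le_haarSum f g s
  have hl := J.length_pos
  have h := haarSum_le hp hpq n hf hg
  rw [one_div_mul_eq_div, div_le_iff₀' (by positivity)] at h
  exact hn.trans h

theorem summable_haarTerm {p q : ℝ} (hp : 2 ≤ p) (hpq : p.HolderConjugate q)
    {f g : ℝ → E} {J : DyadicInterval}
    (hf : MemLp f (ENNReal.ofReal p) (volume.restrict J.toSet))
    (hg : MemLp g (ENNReal.ofReal q) (volume.restrict J.toSet)) :
    Summable fun I : {I : DyadicInterval // I.toSet ⊆ J.toSet} => haarTerm f g I.1 :=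
  summable_of_sum_le (fun I => haarTerm_nonneg f g I.1) (sum_haarTerm_le hp hpq hf hg)

theorem tsum_haarTerm_le {p q : ℝ} (hp : 2 ≤ p) (hpq : p.HolderConjugate q)
    {f g : ℝ → E} {J : DyadicInterval}
    (hf : MemLp f (ENNReal.ofReal p) (volume.restrict J.toSet))
    (hg : MemLp g (ENNReal.ofReal q) (volume.restrict J.toSet)) :
    1 / (4 * J.length) * ∑' I : {I : DyadicInterval // I.toSet ⊆ J.toSet}, haarTerm f g I.1 ≤
      (p - 1) * (J.avg fun x => ‖f x‖ ^ p) ^ (1 / p) * (J.avg fun x => ‖g x‖ ^ q) ^ (1 / q) := by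
  have hl := J.length_pos
  rw [one_div_mul_eq_div, div_le_iff₀' (by positivity)]
  exact (summable_haarTerm hp hpq hf hg).tsum_le_of_sum_le (sum_haarTerm_le hp hpq hf hg)

end

end DyadicInterval

/-- The sum runs over all dyadic intervals `I ⊆ J`, including `J` itself. -/
theorem theorem4p5 {𝕜 E : Type*} [RCLike 𝕜] [NormedAddCommGroup E] [InnerProductSpace 𝕜 E]
    [NormedSpace ℝ E] [CompleteSpace E] [TopologicalSpace.SeparableSpace E]
    (p q : ℝ) (hp : 2 ≤ p) (hpq : 1 / p + 1 / q = 1)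
    (J : DyadicInterval) (f g : ℝ → E)
    (hf : MemLp f (ENNReal.ofReal p) (volume.restrict J.toSet))
    (hg : MemLp g (ENNReal.ofReal q) (volume.restrict J.toSet)) :
    Summable (fun I : {I : DyadicInterval // I.toSet ⊆ J.toSet} =>
      I.1.length * ‖I.1.right.avg f - I.1.left.avg f‖ * ‖I.1.right.avg g - I.1.left.avg g‖) ∧
    1 / (4 * J.length) * ∑' I : {I : DyadicInterval // I.toSet ⊆ J.toSet},
      I.1.length * ‖I.1.right.avg f - I.1.left.avg f‖ * ‖I.1.right.avg g - I.1.left.avg g‖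
      ≤ (p - 1) * (J.avg fun x => ‖f x‖ ^ p) ^ (1 / p) * (J.avg fun x => ‖g x‖ ^ q) ^ (1 / q) := by
  have hconj : p.HolderConjugate q :=
    Real.holderConjugate_iff.2 ⟨by linarith, by simpa only [one_div] using hpq⟩
  -- The parallelogram law yields a real inner product inducing exactly the given real normed
  -- structure, so the averages are unchanged.
  obtain ⟨_, rfl⟩ : ∃ i : InnerProductSpace ℝ E, i.toNormedSpace = ‹NormedSpace ℝ E› :=
    ⟨InnerProductSpace.ofNorm ℝ fun x y => by
      linear_combination parallelogram_law_with_norm 𝕜 x y, rfl⟩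
  exact ⟨DyadicInterval.summable_haarTerm hp hconj hf hg,
    DyadicInterval.tsum_haarTerm_le hp hconj hf hg⟩
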